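/- **Setting.** Fix a canonical single-parameter exponential family (SPEF) $\mathcal S$: a reference measure $\rho$ on $\mathbb R$, an open interval $\Theta\subset\mathbb R$ and a strictly convex $b:\Theta\to\mathbb R$ such that, for each $\theta\in\Theta$, $x\mapsto e^{\theta x-b(\theta)}$ is a probability density with respect to $\rho$; $\mathcal S$ is the set of these distributions. A $K$-armed bandit instance is $\nu=(\nu_1,\dots,\nu_K)\in\mathcal S^K$. In a first phase, $\tau_1$ (a fixed number, possibly $0$) offline samples are collected by an offline policy, which chooses each arm, possibly at random, as a function of the past arms and rewards. Then an online policy, at each step and as a (possibly randomized) function of all offline and online samples so far, either pulls an arm or stops and outputs an arm as best-arm estimate. Each pull of arm $a$ gives a reward drawn from $\nu_a$, independently of the past given the choice of the arm. Let $N^o_a$ be the number of offline samples of arm $a$ and $\tau_\delta\in\{0,1,\dots,\infty\}$ the total number of online samples. Given $\delta>0$ and the offline policy, the online policy is $\delta$-correct if, on every instance $\nu\in\mathcal S^K$ with a unique arm of largest mean, it outputs that arm with probability at least $1-\delta$, the probability being taken jointly over the offline and the online phase. **Theorem.** Let $\mu\in\mathcal S^K$ have a unique arm of largest mean, say arm $1$.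 Then every $\delta$-correct policy satisfies, under $\mu$, $$\mathbb E[\tau_\delta]\ \ge\ T^*,$$ where $T^*$ is the optimal value (infimum) of the problem $$\textbf{(P1)}\quad \min_{N_1,\dots,N_K\ge 0}\ \sum_{a=1}^K N_a\quad\text{s.t.}\quad \inf_{x\in\mathcal S}\Big\{(\mathbb E[N^o_1]+N_1)\,\mathrm{KL}(\mu_1,x)+(\mathbb E[N^o_a]+N_a)\,\mathrm{KL}(\mu_a,x)\Big\}\ \ge\ \log\frac1{2.4\,\delta}\quad\text{for all } a\ne 1 .$$ Here $\mathbb E$ is the expectation under $\mu$ over both phases and $\mathrm{KL}$ is the Kullback-Leibler divergence. -/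

import Mathlib

open MeasureTheory ProbabilityTheory InformationTheory
open scoped ENNReal NNReal

namespace OfflineOnline

/-! ### Single-parameter exponential families -/

/-- A canonical single-parameter exponential family (SPEF) of distributions on `ℝ`: a reference
measure `ρ`, an open interval `Θ` of natural parameters (an interval because strict convexity of
`b` on `Θ` includes convexity of `Θ`) and a strictly convex function `b` on `Θ` such that
`x ↦ exp (θ x - b θ)` is a probability density with respect to `ρ` for every `θ ∈ Θ`.
On an open interval such a `b` is automatically smooth, so this is not a field. -/
structure SPEF where
  /-- the reference measure -/
  ρ : Measure ℝ
  /-- the set of natural parameters -/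
  Θ : Set ℝ
  /-- the log-normalizer -/
  b : ℝ → ℝ
  isOpen_Θ : IsOpen Θ
  strictConvexOn_b : StrictConvexOn ℝ Θ b
  lintegral_density : ∀ θ ∈ Θ, ∫⁻ x, ENNReal.ofReal (Real.exp (θ * x - b θ)) ∂ρ = 1

/-- The collection of distributions that make up the family. -/
def SPEF.family (F : SPEF) : Set (ProbabilityMeasure ℝ) :=
  {p | ∃ θ ∈ F.Θ,
    (p : Measure ℝ) = F.ρ.withDensity fun x => ENNReal.ofReal (Real.exp (θ * x - F.b θ))}

/-- The mean of a distribution on `ℝ`. -/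
noncomputable def mean (p : ProbabilityMeasure ℝ) : ℝ := ∫ x, x ∂(p : Measure ℝ)

/-- The Kullback-Leibler divergence of two distributions on `ℝ`. -/
noncomputable def KL (p q : ProbabilityMeasure ℝ) : ℝ≥0∞ :=
  klDiv (p : Measure ℝ) (q : Measure ℝ)

/-- `i` is the unique best arm of the instance `ν`: the only one with the largest mean. -/
def IsUniqueBest {K : ℕ} (ν : Fin K → ProbabilityMeasure ℝ) (i : Fin K) : Prop :=
  ∀ a, a ≠ i → mean (ν a) < mean (ν i)

/-! ### Policies -/

/-- One sample: the arm that was pulled and the reward that was observed. -/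
abbrev Obs (K : ℕ) : Type := Fin K × ℝ

/-- A decision of the online policy: `Sum.inl a` pulls arm `a`; `Sum.inr k` stops and outputs `k`
as the best-arm estimate. -/
abbrev Decision (K : ℕ) : Type := Fin K ⊕ Fin K

/-- What is recorded in one round: `Sum.inl (a, x)` is a sample, `Sum.inr k` says that the policy
has stopped with the best-arm estimate `k`. -/
abbrev Record (K : ℕ) : Type := Obs K ⊕ Fin K

/-- An offline policy: `rule n` is the conditional law of the arm pulled after `n` samples. -/
structure OfflinePolicy (K : ℕ) where
  rule : (n : ℕ) → Kernel (Fin n → Obs K) (Fin K)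
  markov : ∀ n, IsMarkovKernel (rule n)

/-- An online policy: `rule n` is the conditional law, given all `n` samples observed so far
(offline and online), of the decision to pull some arm or to stop with some best-arm estimate. -/
structure OnlinePolicy (K : ℕ) where
  rule : (n : ℕ) → Kernel (Fin n → Obs K) (Decision K)
  markov : ∀ n, IsMarkovKernel (rule n)

/-! ### The interaction of the policies with a bandit instance -/

section Law

variable {K : ℕ}

/-- Arms are chosen by the offline policy in the first `τ₁` rounds, by the online policy after. -/
noncomputable def decisionRule (τ₁ : ℕ) (off : OfflinePolicy K) (on : OnlinePolicy K) (n : ℕ) :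
    Kernel (Fin n → Obs K) (Decision K) :=
  if n < τ₁ then (off.rule n).map Sum.inl else on.rule n

instance (τ₁ : ℕ) (off : OfflinePolicy K) (on : OnlinePolicy K) (n : ℕ) :
    IsMarkovKernel (decisionRule τ₁ off on n) := by
  have := off.markov n
  have := on.markov n
  unfold decisionRule
  split_ifs
  · exact Kernel.IsMarkovKernel.map _ measurable_inl
  · infer_instance

/-- The answer of the instance `ν` to a decision: pulling arm `a` yields a reward drawn from
`ν a`; stopping is just recorded. -/
noncomputable def response (ν : Fin K → ProbabilityMeasure ℝ) :
    Kernel (Decision K) (Record K) where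
  toFun := Sum.elim
    (fun a => (ν a : Measure ℝ).map fun x => Sum.inl (a, x))
    (fun k => Measure.dirac (Sum.inr k))
  measurable' := Measurable.sumElim (measurable_of_countable _) (measurable_of_countable _)

instance (ν : Fin K → ProbabilityMeasure ℝ) : IsMarkovKernel (response ν) where
  isProbabilityMeasure d := by
    rcases d with a | k
    · exact Measure.isProbabilityMeasure_map (μ := (ν a : Measure ℝ))
        (measurable_inl.comp measurable_prodMk_left).aemeasurable
    · exact Measure.dirac.isProbabilityMeasure (x := (Sum.inr k : Record K))

/-- The conditional law of the next record, given `n` samples and that no stop has occurred. -/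
noncomputable def nextRecord (τ₁ : ℕ) (off : OfflinePolicy K) (on : OnlinePolicy K)
    (ν : Fin K → ProbabilityMeasure ℝ) (n : ℕ) : Kernel (Fin n → Obs K) (Record K) :=
  response ν ∘ₖ decisionRule τ₁ off on n

instance (τ₁ : ℕ) (off : OfflinePolicy K) (on : OnlinePolicy K)
    (ν : Fin K → ProbabilityMeasure ℝ) (n : ℕ) :
    IsMarkovKernel (nextRecord τ₁ off on ν n) := by
  unfold nextRecord
  infer_instance

/-- The sample in a record (the value at a stop is irrelevant: it is never used). -/
def Record.obs : Record K → Obs K := Sum.elim id fun k => (k, 0)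

lemma Record.measurable_obs : Measurable (Record.obs : Record K → Obs K) :=
  Measurable.sumElim measurable_id (by fun_prop)

/-- The samples in the first `n + 1` records. -/
def samples (n : ℕ) (h : Finset.Iic n → Record K) : Fin (n + 1) → Obs K :=
  fun j => Record.obs (h ⟨j, Finset.mem_Iic.2 (Nat.lt_succ_iff.1 j.2)⟩)

lemma measurable_samples (n : ℕ) :
    Measurable (samples n : (Finset.Iic n → Record K) → Fin (n + 1) → Obs K) :=
  measurable_pi_lambda _ fun _ => Record.measurable_obs.comp (measurable_pi_apply _)

/-- The most recent record. -/
def lastRecord (n : ℕ) (h : Finset.Iic n → Record K) : Record K := h ⟨n, Finset.mem_Iic.2 le_rfl⟩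

lemma measurable_lastRecord (n : ℕ) :
    Measurable (lastRecord n : (Finset.Iic n → Record K) → Record K) :=
  measurable_pi_apply _

open scoped Classical in
/-- The conditional law of record `n + 1` given records `0, …, n`: once the policy has stopped,
the stop is repeated forever; before that the policies and the instance produce the record. -/
noncomputable def step (τ₁ : ℕ) (off : OfflinePolicy K) (on : OnlinePolicy K)
    (ν : Fin K → ProbabilityMeasure ℝ) (n : ℕ) :
    Kernel (Finset.Iic n → Record K) (Record K) :=
  Kernel.piecewise
    (s := lastRecord n ⁻¹' Set.range Sum.inr)
    (measurable_lastRecord n measurableSet_range_inr)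
    (Kernel.deterministic (lastRecord n) (measurable_lastRecord n))
    ((nextRecord τ₁ off on ν (n + 1)).comap (samples n) (measurable_samples n))

instance (τ₁ : ℕ) (off : OfflinePolicy K) (on : OnlinePolicy K)
    (ν : Fin K → ProbabilityMeasure ℝ) (n : ℕ) : IsMarkovKernel (step τ₁ off on ν n) := by
  unfold step
  infer_instance

/-- The joint law of all offline and online records, when `τ₁` offline samples are collected by
`off` and the online phase is run by `on`, all rewards being drawn from the instance `ν`. -/
noncomputable def law (τ₁ : ℕ) (off : OfflinePolicy K) (on : OnlinePolicy K)
    (ν : Fin K → ProbabilityMeasure ℝ) : Measure (ℕ → Record K) :=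
  Kernel.trajMeasure (X := fun _ => Record K)
    (nextRecord τ₁ off on ν 0 Fin.elim0) (step τ₁ off on ν)

end Law

/-! ### Sample counts and correctness -/

/-- The number `N^o_a` of offline samples of arm `a`. -/
noncomputable def offlineCount {K : ℕ} (τ₁ : ℕ) (a : Fin K) (ω : ℕ → Record K) : ℝ≥0∞ :=
  ∑ n ∈ Finset.range τ₁, {r : Record K | ∃ x, r = Sum.inl (a, x)}.indicator 1 (ω n)

/-- The total number `τ_δ` of online samples, possibly infinite. -/
noncomputable def onlineTime {K : ℕ} (τ₁ : ℕ) (ω : ℕ → Record K) : ℝ≥0∞ :=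
  ∑' t : ℕ, (Set.range Sum.inl : Set (Record K)).indicator 1 (ω (τ₁ + t))

/-- The run `ω` stops and outputs `k`. -/
def Outputs {K : ℕ} (ω : ℕ → Record K) (k : Fin K) : Prop := ∃ n, ω n = Sum.inr k

/-- The online policy `on` is `δ`-correct on the family `F` (with `τ₁` offline samples collected by
`off`): on every instance with a unique best arm, the probability, over offline and online
randomness jointly, of not outputting that arm is at most `δ`. -/
def IsDeltaCorrect {K : ℕ} (F : SPEF) (τ₁ : ℕ) (off : OfflinePolicy K) (on : OnlinePolicy K)
    (δ : ℝ) : Prop :=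
  ∀ ν : Fin K → ProbabilityMeasure ℝ, (∀ a, ν a ∈ F.family) →
    ∀ i, IsUniqueBest ν i → law τ₁ off on ν {ω | ¬ Outputs ω i} ≤ ENNReal.ofReal δ

/-! ### The lower-bound problem -/

/-- `S_{i,a}(N) = inf_x { (No_i + N_i) KL(μ_i, x) + (No_a + N_a) KL(μ_a, x) }`, the infimum being
over the distributions `x` of the family. -/
noncomputable def index {K : ℕ} (F : SPEF) (μ : Fin K → ProbabilityMeasure ℝ)
    (No : Fin K → ℝ≥0∞) (i a : Fin K) (N : Fin K → ℝ≥0) : ℝ≥0∞ :=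
  ⨅ x ∈ F.family, (No i + N i) * KL (μ i) x + (No a + N a) * KL (μ a) x

/-- The allocations that are feasible for the lower-bound problem with best arm `i` and expected
offline counts `No`. As the index is nonnegative, truncating the right side at `0` is harmless. -/
def Feasible {K : ℕ} (F : SPEF) (μ : Fin K → ProbabilityMeasure ℝ)
    (No : Fin K → ℝ≥0∞) (i : Fin K) (δ : ℝ) (N : Fin K → ℝ≥0) : Prop :=
  ∀ a, a ≠ i → ENNReal.ofReal (Real.log (1 / (2.4 * δ))) ≤ index F μ No i a N

/-- The optimal value `T*` of the lower-bound problem: minimize `∑ N_a` over feasible `N`. -/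
noncomputable def optimalValue {K : ℕ} (F : SPEF) (μ : Fin K → ProbabilityMeasure ℝ)
    (No : Fin K → ℝ≥0∞) (i : Fin K) (δ : ℝ) : ℝ≥0∞ :=
  ⨅ (N : Fin K → ℝ≥0) (_ : Feasible F μ No i δ N), ∑ a, (N a : ℝ≥0∞)

end OfflineOnline

/-! The witness for the optimization problem is the vector of expected online pulls under `μ`: its
sum is the expected online time, so only feasibility has to be shown. If that time is infinite,
nothing is left to prove.

Feasibility is a change of measure. Let `ν` be an instance of the family whose best arm is not `i`.
The policy decides by the same kernels under `μ` and `ν`, so the likelihood ratio involves rewards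
only (`lintegral_law_change`). Its expected logarithm is the sum over arms of expected pulls times
divergence, by Wald's identity taken round by round (`integral_law`). Gibbs' inequality with a
two-valued test function (`gibbs_le_sum_div`) bounds this below by the binary divergence between `1
- δ` and `δ`, which is at least `log (1 / (2.4 * δ))` (`log_le_binary_div`). The argument uses a
fixed horizon which then tends to infinity, so no optional stopping is needed. The outcome is
`log_le_sum_expectedPulls_mul_div`.

For a constraint at `a` and a member `x`, both `i` and `a` are moved to `x`. Then `i` is no longer
the unique best arm, and an arbitrarily small push makes some other arm uniquely best. The cost of
the push vanishes in the limit (`log_le_mul_div_add`). -/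

namespace OfflineOnline

open Filter Topology

/-! ### Exponential families -/

namespace SPEF

variable (F : SPEF)

/-- The member of the family with natural parameter `θ`. -/
noncomputable def dist (θ : ℝ) : Measure ℝ :=
  F.ρ.withDensity fun x => ENNReal.ofReal (Real.exp (θ * x - F.b θ))

/-- The mean of the member of the family with natural parameter `θ`. -/
noncomputable def m (θ : ℝ) : ℝ := ∫ x, x ∂F.dist θ

variable {F}

lemma isProbabilityMeasure_dist {θ : ℝ} (hθ : θ ∈ F.Θ) : IsProbabilityMeasure (F.dist θ) :=
  ⟨by rw [dist, withDensity_apply _ MeasurableSet.univ, Measure.restrict_univ,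
    F.lintegral_density θ hθ]⟩

/-- Two members differ by an exponential tilt, so the reference measure drops out of all later
arguments. -/
lemma dist_eq_withDensity (θ θ' : ℝ) :
    F.dist θ' = (F.dist θ).withDensity fun x =>
      ENNReal.ofReal (Real.exp ((θ' - θ) * x - (F.b θ' - F.b θ))) := by
  rw [dist, dist, ← withDensity_mul _ (by fun_prop) (by fun_prop)]
  congr 1
  ext x
  rw [Pi.mul_apply, ← ENNReal.ofReal_mul (Real.exp_pos _).le, ← Real.exp_add]
  ring_nf

lemma lintegral_dist_ratio {θ θ' : ℝ} (hθ' : θ' ∈ F.Θ) :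
    ∫⁻ x, ENNReal.ofReal (Real.exp ((θ' - θ) * x - (F.b θ' - F.b θ))) ∂F.dist θ = 1 := by
  have := isProbabilityMeasure_dist hθ'
  have h : F.dist θ' Set.univ = 1 := measure_univ
  rwa [dist_eq_withDensity θ θ', withDensity_apply _ MeasurableSet.univ,
    Measure.restrict_univ] at h

lemma integrable_ratio {θ θ' : ℝ} (hθ' : θ' ∈ F.Θ) :
    Integrable (fun x => Real.exp ((θ' - θ) * x - (F.b θ' - F.b θ))) (F.dist θ) := by
  refine ⟨by fun_prop, ?_⟩
  rw [hasFiniteIntegral_iff_ofReal (ae_of_all _ fun x => (Real.exp_pos _).le),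
    lintegral_dist_ratio hθ']
  exact ENNReal.one_lt_top

lemma integral_ratio {θ θ' : ℝ} (hθ' : θ' ∈ F.Θ) :
    ∫ x, Real.exp ((θ' - θ) * x - (F.b θ' - F.b θ)) ∂F.dist θ = 1 := by
  rw [integral_eq_lintegral_of_nonneg_ae (ae_of_all _ fun x => (Real.exp_pos _).le) (by fun_prop),
    lintegral_dist_ratio hθ', ENNReal.toReal_one]

lemma integrable_exp_mul {θ θ' : ℝ} (hθ' : θ' ∈ F.Θ) :
    Integrable (fun x => Real.exp ((θ' - θ) * x)) (F.dist θ) := by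
  refine ((integrable_ratio hθ').const_mul (Real.exp (F.b θ' - F.b θ))).congr
    (ae_of_all _ fun x => ?_)
  simp only [← Real.exp_add]
  ring_nf

/-- Openness of `Θ` gives exponential moments on both sides of `θ`, and these dominate `|x|`. -/
lemma integrable_id_dist {θ : ℝ} (hθ : θ ∈ F.Θ) : Integrable (fun x => x) (F.dist θ) := by
  obtain ⟨ε, hε, hball⟩ := Metric.isOpen_iff.1 F.isOpen_Θ θ hθ
  have hmem : ∀ s : ℝ, |s| < ε → θ + s ∈ F.Θ := fun s hs =>
    hball (by simpa [Real.dist_eq] using hs)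
  have h2 : |ε / 2| < ε := by rw [abs_of_pos (by linarith)]; linarith
  have h1 := integrable_exp_mul (θ := θ) (hmem (ε / 2) h2)
  have h3 := integrable_exp_mul (θ := θ) (hmem (-(ε / 2)) (by rwa [abs_neg]))
  refine ((h1.add h3).const_mul (2 / ε)).mono' (by fun_prop) (ae_of_all _ fun x => ?_)
  simp only [add_sub_cancel_left, Pi.add_apply, Real.norm_eq_abs]
  have e1 := Real.add_one_le_exp (ε / 2 * x)
  have e2 := Real.add_one_le_exp (-(ε / 2) * x)
  have e3 := Real.exp_pos (ε / 2 * x)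
  have e4 := Real.exp_pos (-(ε / 2) * x)
  have key : ε / 2 * |x| ≤ Real.exp (ε / 2 * x) + Real.exp (-(ε / 2) * x) := by
    rcases abs_cases x with ⟨h, _⟩ | ⟨h, _⟩ <;> rw [h] <;> linarith
  calc |x| = 2 / ε * (ε / 2 * |x|) := by field_simp
    _ ≤ _ := by gcongr

/-- The Kullback-Leibler divergence in terms of the natural parameters. -/
noncomputable def div (F : SPEF) (θ θ' : ℝ) : ℝ := F.b θ' - F.b θ - (θ' - θ) * F.m θ

lemma integrable_logRatio {θ : ℝ} (hθ : θ ∈ F.Θ) (θ' : ℝ) :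
    Integrable (fun x => (θ - θ') * x - (F.b θ - F.b θ')) (F.dist θ) := by
  have := isProbabilityMeasure_dist hθ
  exact ((integrable_id_dist hθ).const_mul _).sub (integrable_const _)

lemma integral_logRatio {θ : ℝ} (hθ : θ ∈ F.Θ) (θ' : ℝ) :
    ∫ x, ((θ - θ') * x - (F.b θ - F.b θ')) ∂F.dist θ = F.div θ θ' := by
  have := isProbabilityMeasure_dist hθ
  rw [integral_sub ((integrable_id_dist hθ).const_mul _) (integrable_const _),
    integral_const_mul, integral_const, div, m]
  simp
  ring

/-- Integrate `1 + y ≤ exp y` at the log-density. Equivalently, `F.m θ` is a subgradient of `b` at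
`θ`. -/
lemma div_nonneg {θ θ' : ℝ} (hθ : θ ∈ F.Θ) (hθ' : θ' ∈ F.Θ) : 0 ≤ F.div θ θ' := by
  have := isProbabilityMeasure_dist hθ
  have h : ∫ x, (1 - ((θ - θ') * x - (F.b θ - F.b θ'))) ∂F.dist θ ≤
      ∫ x, Real.exp ((θ' - θ) * x - (F.b θ' - F.b θ)) ∂F.dist θ := by
    refine integral_mono ((integrable_const _).sub (integrable_logRatio hθ θ'))
      (integrable_ratio hθ') fun x => ?_
    have := Real.add_one_le_exp ((θ' - θ) * x - (F.b θ' - F.b θ))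
    simp only
    linarith
  rw [integral_sub (integrable_const _) (integrable_logRatio hθ θ'), integral_logRatio hθ,
    integral_ratio hθ'] at h
  simp at h
  exact h

/-- The subgradient inequalities from both ends, taken at the midpoint, contradict strict convexity
unless the slopes increase. No derivative of `b` is used. -/
lemma m_strictMonoOn : StrictMonoOn F.m F.Θ := by
  intro θ hθ θ' hθ' hlt
  have hmid : (1 / 2 : ℝ) • θ + (1 / 2 : ℝ) • θ' ∈ F.Θ :=
    F.strictConvexOn_b.1 hθ hθ' (by norm_num) (by norm_num) (by norm_num)
  have h : F.b ((1 / 2 : ℝ) • θ + (1 / 2 : ℝ) • θ') <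
      (1 / 2 : ℝ) • F.b θ + (1 / 2 : ℝ) • F.b θ' :=
    F.strictConvexOn_b.2 hθ hθ' hlt.ne (by norm_num) (by norm_num) (by norm_num)
  have h1 := div_nonneg hθ hmid
  have h2 := div_nonneg hθ' hmid
  simp only [smul_eq_mul, div] at h h1 h2
  by_contra! hle
  nlinarith

lemma continuousOn_b : ContinuousOn F.b F.Θ :=
  F.strictConvexOn_b.convexOn.continuousOn F.isOpen_Θ

lemma klDiv_dist {θ θ' : ℝ} (hθ : θ ∈ F.Θ) (hθ' : θ' ∈ F.Θ) :
    klDiv (F.dist θ) (F.dist θ') = ENNReal.ofReal (F.div θ θ') := by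
  have := isProbabilityMeasure_dist hθ
  have := isProbabilityMeasure_dist hθ'
  have hac : F.dist θ ≪ F.dist θ' := by
    rw [dist_eq_withDensity θ' θ]
    exact withDensity_absolutelyContinuous _ _
  have hllr : llr (F.dist θ) (F.dist θ') =ᵐ[F.dist θ]
      fun x => (θ - θ') * x - (F.b θ - F.b θ') := by
    have h := Measure.rnDeriv_withDensity (F.dist θ') (f := fun x =>
      ENNReal.ofReal (Real.exp ((θ - θ') * x - (F.b θ - F.b θ')))) (by fun_prop)
    rw [← dist_eq_withDensity θ' θ] at h
    filter_upwards [hac.ae_le h] with x hx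
    rw [llr, hx, ENNReal.toReal_ofReal (Real.exp_pos _).le, Real.log_exp]
  rw [klDiv_of_ac_of_integrable hac ((integrable_logRatio hθ θ').congr hllr.symm),
    integral_congr_ae hllr, integral_logRatio hθ]
  simp

end SPEF

/-! ### The law of the records -/

section Law

variable {K : ℕ}

/-- The records of pulls of arm `a`. -/
def armSet (a : Fin K) : Set (Record K) := {r | ∃ x, r = Sum.inl (a, x)}

lemma armSet_eq (a : Fin K) : armSet a = Sum.inl '' (Prod.fst ⁻¹' {a} : Set (Obs K)) := by
  ext r
  rcases r with ⟨b, x⟩ | k <;> simp [armSet]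

lemma measurableSet_armSet (a : Fin K) : MeasurableSet (armSet a) := by
  rw [armSet_eq]
  exact (measurable_fst (measurableSet_singleton a)).inl_image

lemma dirac_inr_armSet (k a : Fin K) :
    Measure.dirac (Sum.inr k : Record K) (armSet a) = 0 := by
  rw [Measure.dirac_apply' _ (measurableSet_armSet a)]
  simp [armSet]

lemma measurable_inl_mk (a : Fin K) :
    Measurable fun x : ℝ => (Sum.inl (a, x) : Record K) :=
  measurable_inl.comp measurable_prodMk_left

lemma sum_indicator_armSet (r : Record K) :
    ∑ a, (armSet a).indicator (1 : Record K → ℝ≥0∞) r =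
      (Set.range Sum.inl : Set (Record K)).indicator 1 r := by
  rcases r with ⟨b, x⟩ | k
  · rw [Finset.sum_eq_single b]
    · simp [armSet]
    · intro a _ hab
      exact Set.indicator_of_notMem (by simp [armSet, hab.symm]) _
    · simp
  · simp [armSet]

/-! ### One-step disintegration of the law -/

variable (τ₁ : ℕ) (off : OfflinePolicy K) (on : OnlinePolicy K)

instance (ν : Fin K → ProbabilityMeasure ℝ) : IsProbabilityMeasure (law τ₁ off on ν) := by
  unfold law
  infer_instance

lemma map_zero_law (ν : Fin K → ProbabilityMeasure ℝ) :
    (law τ₁ off on ν).map (fun ω => ω 0) = nextRecord τ₁ off on ν 0 Fin.elim0 := by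
  have h1 : (fun ω : ℕ → Record K => ω 0) =
      (MeasurableEquiv.piUnique fun _ : Finset.Iic 0 => Record K) ∘ Preorder.frestrictLe 0 := by
    ext ω
    rfl
  rw [h1, ← Measure.map_map (by fun_prop) (by fun_prop), law, Kernel.trajMeasure,
    Measure.map_comp _ _ (by fun_prop), Kernel.traj_map_frestrictLe, Kernel.partialTraj_self,
    Measure.id_comp, Measure.map_map (by fun_prop) (by fun_prop)]
  convert Measure.map_id
  ext
  simp

lemma lintegral_law_zero (ν : Fin K → ProbabilityMeasure ℝ) {g : Record K → ℝ≥0∞}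
    (hg : Measurable g) :
    ∫⁻ ω, g (ω 0) ∂law τ₁ off on ν = ∫⁻ r, g r ∂nextRecord τ₁ off on ν 0 Fin.elim0 := by
  rw [← map_zero_law, lintegral_map hg (measurable_pi_apply 0)]

/-- The tower property given records `0, …, n`. -/
lemma lintegral_law_succ (ν : Fin K → ProbabilityMeasure ℝ) (n : ℕ)
    {g : (Finset.Iic n → Record K) × Record K → ℝ≥0∞} (hg : Measurable g) :
    ∫⁻ ω, g (Preorder.frestrictLe n ω, ω (n + 1)) ∂law τ₁ off on ν =
      ∫⁻ ω, ∫⁻ r, g (Preorder.frestrictLe n ω, r)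
        ∂step τ₁ off on ν n (Preorder.frestrictLe n ω) ∂law τ₁ off on ν := by
  have h := Kernel.map_frestrictLe_trajMeasure_compProd_eq_map_trajMeasure
    (X := fun _ => Record K) (μ₀ := nextRecord τ₁ off on ν 0 Fin.elim0)
    (κ := step τ₁ off on ν) (a := n)
  change (law τ₁ off on ν).map _ ⊗ₘ _ = (law τ₁ off on ν).map _ at h
  rw [← lintegral_map (μ := law τ₁ off on ν)
      (g := fun ω => (Preorder.frestrictLe n ω, ω (n + 1))) hg (by fun_prop), ← h,
    Measure.lintegral_compProd hg, lintegral_map hg.lintegral_kernel_prod_right' (by fun_prop)]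

lemma step_of_stopped (ν : Fin K → ProbabilityMeasure ℝ) (n : ℕ)
    (h : Finset.Iic n → Record K) {k : Fin K} (hk : lastRecord n h = Sum.inr k) :
    step τ₁ off on ν n h = Measure.dirac (Sum.inr k) := by
  classical
  rw [step, Kernel.piecewise_apply, if_pos (show h ∈ lastRecord n ⁻¹' Set.range Sum.inr from
    ⟨k, hk.symm⟩), Kernel.deterministic_apply, hk]

lemma step_of_running (ν : Fin K → ProbabilityMeasure ℝ) (n : ℕ)
    (h : Finset.Iic n → Record K) (hh : ∀ k, lastRecord n h ≠ Sum.inr k) :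
    step τ₁ off on ν n h = nextRecord τ₁ off on ν (n + 1) (samples n h) := by
  classical
  rw [step, Kernel.piecewise_apply, if_neg (show h ∉ lastRecord n ⁻¹' Set.range Sum.inr from
    fun ⟨k, hk⟩ => hh k hk.symm), Kernel.comap_apply]

lemma response_inl (ν : Fin K → ProbabilityMeasure ℝ) (a : Fin K) :
    response ν (Sum.inl a) = (ν a : Measure ℝ).map fun x => Sum.inl (a, x) := rfl

lemma response_inr (ν : Fin K → ProbabilityMeasure ℝ) (k : Fin K) :
    response ν (Sum.inr k) = Measure.dirac (Sum.inr k) := rfl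

lemma lintegral_nextRecord (ν : Fin K → ProbabilityMeasure ℝ) (n : ℕ) (h : Fin n → Obs K)
    {g : Record K → ℝ≥0∞} (hg : Measurable g) :
    ∫⁻ r, g r ∂nextRecord τ₁ off on ν n h =
      ∫⁻ d, ∫⁻ r, g r ∂response ν d ∂decisionRule τ₁ off on n h := by
  rw [nextRecord, Kernel.lintegral_comp _ _ _ hg]

/-! #### The arm of a record and its reward -/

section Marginal

variable (ν : Fin K → ProbabilityMeasure ℝ)

lemma lintegral_response_eq_sum (d : Decision K) {g : Record K → ℝ≥0∞} (hg : Measurable g)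
    (hg0 : ∀ k, g (Sum.inr k) = 0) :
    ∫⁻ r, g r ∂response ν d =
      ∑ a, response ν d (armSet a) * ∫⁻ x, g (Sum.inl (a, x)) ∂(ν a : Measure ℝ) := by
  rcases d with b | k
  · have harm : ∀ a, response ν (Sum.inl b) (armSet a) = if a = b then 1 else 0 := by
      intro a
      rw [response_inl, Measure.map_apply (measurable_inl_mk b) (measurableSet_armSet a)]
      split_ifs with h
      · subst h
        simp [armSet]
      · simp [armSet, Ne.symm h]
    simp_rw [harm, response_inl, lintegral_map hg (measurable_inl_mk b)]
    simp
  · simp [response_inr, lintegral_dirac' _ hg, hg0, dirac_inr_armSet]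

lemma lintegral_nextRecord_eq_sum (n : ℕ) (h : Fin n → Obs K) {g : Record K → ℝ≥0∞}
    (hg : Measurable g) (hg0 : ∀ k, g (Sum.inr k) = 0) :
    ∫⁻ r, g r ∂nextRecord τ₁ off on ν n h =
      ∑ a, nextRecord τ₁ off on ν n h (armSet a) *
        ∫⁻ x, g (Sum.inl (a, x)) ∂(ν a : Measure ℝ) := by
  rw [lintegral_nextRecord τ₁ off on ν n h hg,
    lintegral_congr fun d => lintegral_response_eq_sum ν d hg hg0,
    lintegral_finsetSum _ fun a _ =>
      ((response ν).measurable_coe (measurableSet_armSet a)).mul_const _]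
  refine Finset.sum_congr rfl fun a _ => ?_
  rw [lintegral_mul_const _ ((response ν).measurable_coe (measurableSet_armSet a)), nextRecord,
    Kernel.comp_apply' _ _ _ (measurableSet_armSet a)]

lemma lintegral_step_eq_sum (n : ℕ) (h : Finset.Iic n → Record K) {g : Record K → ℝ≥0∞}
    (hg : Measurable g) (hg0 : ∀ k, g (Sum.inr k) = 0) :
    ∫⁻ r, g r ∂step τ₁ off on ν n h =
      ∑ a, step τ₁ off on ν n h (armSet a) *
        ∫⁻ x, g (Sum.inl (a, x)) ∂(ν a : Measure ℝ) := by
  by_cases hh : ∃ k, lastRecord n h = Sum.inr k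
  · obtain ⟨k, hk⟩ := hh
    simp [step_of_stopped τ₁ off on ν n h hk, lintegral_dirac' _ hg, hg0, dirac_inr_armSet]
  · push Not at hh
    rw [step_of_running τ₁ off on ν n h hh, lintegral_nextRecord_eq_sum _ _ _ _ _ _ hg hg0]

lemma law_armSet_succ (n : ℕ) (a : Fin K) :
    ∫⁻ ω, step τ₁ off on ν n (Preorder.frestrictLe n ω) (armSet a) ∂law τ₁ off on ν =
      law τ₁ off on ν {ω | ω (n + 1) ∈ armSet a} := by
  have h := lintegral_law_succ τ₁ off on ν n (g := fun p => (armSet a).indicator 1 p.2)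
    ((measurable_one.indicator (measurableSet_armSet a)).comp measurable_snd)
  simp only [lintegral_indicator_one (measurableSet_armSet a)] at h
  rw [← h]
  exact lintegral_indicator_one (s := {ω : ℕ → Record K | ω (n + 1) ∈ armSet a})
    (measurable_pi_apply (n + 1) (measurableSet_armSet a))

/-- Wald's identity for a single round: given the arm, the reward is independent of the past, so the
history enters only through the arm probabilities. -/
lemma lintegral_law_eq_sum (n : ℕ) {g : Record K → ℝ≥0∞}
    (hg : Measurable g) (hg0 : ∀ k, g (Sum.inr k) = 0) :
    ∫⁻ ω, g (ω n) ∂law τ₁ off on ν =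
      ∑ a, law τ₁ off on ν {ω | ω n ∈ armSet a} *
        ∫⁻ x, g (Sum.inl (a, x)) ∂(ν a : Measure ℝ) := by
  cases n with
  | zero =>
    rw [lintegral_law_zero _ _ _ _ hg, lintegral_nextRecord_eq_sum _ _ _ _ _ _ hg hg0]
    refine Finset.sum_congr rfl fun a _ => ?_
    rw [← map_zero_law, Measure.map_apply (measurable_pi_apply 0) (measurableSet_armSet a)]
    rfl
  | succ n =>
    rw [lintegral_law_succ τ₁ off on ν n (g := fun p => g p.2) (hg.comp measurable_snd)]
    simp only [lintegral_step_eq_sum τ₁ off on ν n _ hg hg0]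
    have hmeas : ∀ a, Measurable fun ω : ℕ → Record K =>
        step τ₁ off on ν n (Preorder.frestrictLe n ω) (armSet a) := fun a =>
      ((step τ₁ off on ν n).measurable_coe (measurableSet_armSet a)).comp (by fun_prop)
    rw [lintegral_finsetSum _ fun a _ => (hmeas a).mul_const _]
    refine Finset.sum_congr rfl fun a _ => ?_
    rw [lintegral_mul_const _ (hmeas a), law_armSet_succ]

/-- The law of record `n`, restricted to pulls, as a mixture of the reward distributions. -/
lemma map_law_restrict_range_inl (n : ℕ) :
    ((law τ₁ off on ν).map fun ω => ω n).restrict (Set.range Sum.inl) =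
      ∑ a, law τ₁ off on ν {ω | ω n ∈ armSet a} •
        (ν a : Measure ℝ).map fun x => Sum.inl (a, x) := by
  ext s hs
  have hs' : MeasurableSet (s ∩ Set.range (Sum.inl : Obs K → Record K)) :=
    hs.inter measurableSet_range_inl
  have h := lintegral_law_eq_sum τ₁ off on ν n
    (g := (s ∩ Set.range Sum.inl).indicator 1) (measurable_one.indicator hs') (by simp)
  rw [Measure.restrict_apply hs, ← lintegral_indicator_one hs',
    lintegral_map (measurable_one.indicator hs') (measurable_pi_apply n), h,
    Measure.finsetSum_apply]
  refine Finset.sum_congr rfl fun a _ => ?_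
  rw [Measure.smul_apply, smul_eq_mul, Measure.map_apply (measurable_inl_mk a) hs,
    ← lintegral_indicator_one (measurable_inl_mk a hs)]
  refine congrArg _ (lintegral_congr fun x => ?_)
  by_cases hx : (Sum.inl (a, x) : Record K) ∈ s
  · exact (Set.indicator_of_mem (s := s ∩ Set.range Sum.inl) ⟨hx, (a, x), rfl⟩ 1).trans
      (Set.indicator_of_mem (s := (fun x : ℝ => (Sum.inl (a, x) : Record K)) ⁻¹' s) hx 1).symm
  · exact (Set.indicator_of_notMem (s := s ∩ Set.range Sum.inl) (fun h => hx h.1) 1).trans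
      (Set.indicator_of_notMem (s := (fun x : ℝ => (Sum.inl (a, x) : Record K)) ⁻¹' s) hx 1).symm

/-- Log-likelihood ratios are signed, so the identity for nonnegative functions does not suffice;
the mixture form of the law transfers to Bochner integrals. -/
lemma integrable_law {f : Record K → ℝ} (hf : Measurable f) (hf0 : ∀ k, f (Sum.inr k) = 0)
    (hint : ∀ a, Integrable (fun x => f (Sum.inl (a, x))) (ν a : Measure ℝ)) (n : ℕ) :
    Integrable (fun ω => f (ω n)) (law τ₁ off on ν) := by
  have h : Integrable f (((law τ₁ off on ν).map fun ω => ω n).restrict (Set.range Sum.inl)) := by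
    rw [map_law_restrict_range_inl, integrable_finsetSum_measure]
    refine fun a _ => Integrable.smul_measure ?_ (measure_ne_top _ _)
    exact (integrable_map_measure hf.aestronglyMeasurable
      (measurable_inl_mk a).aemeasurable).2 (hint a)
  have h2 : Integrable f ((law τ₁ off on ν).map fun ω => ω n) := by
    refine IntegrableOn.integrable_of_forall_notMem_eq_zero (s := Set.range Sum.inl) h ?_
    rintro (r | k) hr
    · simp at hr
    · exact hf0 k
  exact h2.comp_measurable (measurable_pi_apply n)

lemma integral_law {f : Record K → ℝ} (hf : Measurable f) (hf0 : ∀ k, f (Sum.inr k) = 0)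
    (hint : ∀ a, Integrable (fun x => f (Sum.inl (a, x))) (ν a : Measure ℝ)) (n : ℕ) :
    ∫ ω, f (ω n) ∂law τ₁ off on ν = ∑ a, (law τ₁ off on ν).real {ω | ω n ∈ armSet a} *
      ∫ x, f (Sum.inl (a, x)) ∂(ν a : Measure ℝ) := by
  have h : ∫ r, f r ∂(law τ₁ off on ν).map (fun ω => ω n) =
      ∫ r in Set.range Sum.inl, f r ∂(law τ₁ off on ν).map (fun ω => ω n) := by
    refine (setIntegral_eq_integral_of_forall_compl_eq_zero ?_).symm
    rintro (r | k) hr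
    · simp at hr
    · exact hf0 k
  rw [← integral_map (φ := fun ω : ℕ → Record K => ω n) (f := f)
      (measurable_pi_apply n).aemeasurable hf.aestronglyMeasurable, h, map_law_restrict_range_inl, integral_finsetSum_measure]
  · refine Finset.sum_congr rfl fun a _ => ?_
    rw [integral_smul_measure, integral_map (measurable_inl_mk a).aemeasurable
      hf.aestronglyMeasurable, smul_eq_mul, Measure.real]
  · refine fun a _ => Integrable.smul_measure ?_ (measure_ne_top _ _)
    exact (integrable_map_measure hf.aestronglyMeasurable
      (measurable_inl_mk a).aemeasurable).2 (hint a)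

end Marginal

/-! #### Stopping -/

/-- After a stop the step kernel is a Dirac mass, so the indicator of leaving the stopped state
integrates to zero. -/
lemma law_stopped_succ (ν : Fin K → ProbabilityMeasure ℝ) (n : ℕ) (k : Fin K) :
    ∀ᵐ ω ∂law τ₁ off on ν, ω n = Sum.inr k → ω (n + 1) = Sum.inr k := by
  have hS : MeasurableSet ({Sum.inr k} : Set (Record K)) := by
    rw [← Set.image_singleton]
    exact (measurableSet_singleton k).inr_image
  have hT : MeasurableSet {p : (Finset.Iic n → Record K) × Record K |
      lastRecord n p.1 ∈ ({Sum.inr k} : Set (Record K)) ∧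
        p.2 ∈ ({Sum.inr k} : Set (Record K))ᶜ} :=
    (((measurable_lastRecord n).comp measurable_fst) hS).inter (measurable_snd hS.compl)
  have h := lintegral_law_succ τ₁ off on ν n (measurable_one.indicator hT)
  have h0 : ∀ ω : ℕ → Record K, ∫⁻ r, Set.indicator {p : (Finset.Iic n → Record K) × Record K |
      lastRecord n p.1 ∈ ({Sum.inr k} : Set (Record K)) ∧
        p.2 ∈ ({Sum.inr k} : Set (Record K))ᶜ} 1 (Preorder.frestrictLe n ω, r)
        ∂step τ₁ off on ν n (Preorder.frestrictLe n ω) = (0 : ℝ≥0∞) := by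
    intro ω
    by_cases hω : lastRecord n (Preorder.frestrictLe n ω) = Sum.inr k
    · rw [step_of_stopped _ _ _ _ _ _ hω, lintegral_dirac' (Sum.inr k) (f := fun r =>
        Set.indicator _ 1 (Preorder.frestrictLe n ω, r))
        ((measurable_one.indicator hT).comp measurable_prodMk_left)]
      simp
    · simp [hω]
  simp only [h0, lintegral_zero] at h
  have hm : Measurable fun ω : ℕ → Record K => (Preorder.frestrictLe n ω, ω (n + 1)) := by
    fun_prop
  have h := (lintegral_eq_zero_iff ((measurable_one.indicator hT).comp hm)).1 h
  filter_upwards [h] with ω hω hn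
  simp at hω
  exact hω hn

lemma law_stopped_mono (ν : Fin K → ProbabilityMeasure ℝ) :
    ∀ᵐ ω ∂law τ₁ off on ν, ∀ k, ∀ n m, n ≤ m → ω n = Sum.inr k → ω m = Sum.inr k := by
  have h : ∀ᵐ ω ∂law τ₁ off on ν, ∀ k n, ω n = Sum.inr k → ω (n + 1) = Sum.inr k :=
    ae_all_iff.2 fun k => ae_all_iff.2 fun n => law_stopped_succ τ₁ off on ν n k
  filter_upwards [h] with ω hω k n m hnm hn
  induction m, hnm using Nat.le_induction with
  | base => exact hn
  | succ m _ ih => exact hω k m ih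

/-! #### Change of measure -/

section ChangeOfMeasure

variable {μ ν : Fin K → ProbabilityMeasure ℝ} {w : Record K → ℝ≥0∞}

/-- The decision is held fixed, so only the reward density changes; a stop carries no information,
whence weight `1`. -/
lemma lintegral_response_change (hw : Measurable w) (hw1 : ∀ k, w (Sum.inr k) = 1)
    (hdens : ∀ a, (ν a : Measure ℝ) = (μ a : Measure ℝ).withDensity fun x => w (Sum.inl (a, x)))
    (d : Decision K) {g : Record K → ℝ≥0∞} (hg : Measurable g) :
    ∫⁻ r, g r ∂response ν d = ∫⁻ r, w r * g r ∂response μ d := by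
  have hwg : Measurable fun r => w r * g r := hw.mul hg
  rcases d with a | k
  · rw [response_inl, response_inl, lintegral_map hg (measurable_inl_mk a),
      lintegral_map hwg (measurable_inl_mk a), hdens a,
      lintegral_withDensity_eq_lintegral_mul (μ a : Measure ℝ)
        (f := fun x => w (Sum.inl (a, x))) (hw.comp (measurable_inl_mk a))
        (g := fun x => g (Sum.inl (a, x))) (hg.comp (measurable_inl_mk a))]
    rfl
  · rw [response_inr, response_inr, lintegral_dirac' _ hg, lintegral_dirac' _ hwg, hw1,
      one_mul]

lemma lintegral_nextRecord_change (hw : Measurable w) (hw1 : ∀ k, w (Sum.inr k) = 1)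
    (hdens : ∀ a, (ν a : Measure ℝ) = (μ a : Measure ℝ).withDensity fun x => w (Sum.inl (a, x)))
    (n : ℕ) (h : Fin n → Obs K) {g : Record K → ℝ≥0∞} (hg : Measurable g) :
    ∫⁻ r, g r ∂nextRecord τ₁ off on ν n h = ∫⁻ r, w r * g r ∂nextRecord τ₁ off on μ n h := by
  have hwg : Measurable fun r => w r * g r := hw.mul hg
  rw [lintegral_nextRecord _ _ _ _ _ _ hg, lintegral_nextRecord _ _ _ _ _ _ hwg]
  exact lintegral_congr fun d => lintegral_response_change hw hw1 hdens d hg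

lemma lintegral_step_change (hw : Measurable w) (hw1 : ∀ k, w (Sum.inr k) = 1)
    (hdens : ∀ a, (ν a : Measure ℝ) = (μ a : Measure ℝ).withDensity fun x => w (Sum.inl (a, x)))
    (n : ℕ) (h : Finset.Iic n → Record K) {g : Record K → ℝ≥0∞} (hg : Measurable g) :
    ∫⁻ r, g r ∂step τ₁ off on ν n h = ∫⁻ r, w r * g r ∂step τ₁ off on μ n h := by
  have hwg : Measurable fun r => w r * g r := hw.mul hg
  by_cases hh : ∃ k, lastRecord n h = Sum.inr k
  · obtain ⟨k, hk⟩ := hh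
    rw [step_of_stopped _ _ _ _ _ _ hk, step_of_stopped _ _ _ _ _ _ hk, lintegral_dirac' _ hg,
      lintegral_dirac' _ hwg, hw1, one_mul]
  · push Not at hh
    rw [step_of_running _ _ _ _ _ _ hh, step_of_running _ _ _ _ _ _ hh,
      lintegral_nextRecord_change _ _ _ hw hw1 hdens _ _ hg]

/-- Appends a record to the records `0, …, n`. -/
def appendRecord (n : ℕ) (p : (Finset.Iic n → Record K) × Record K) :
    Finset.Iic (n + 1) → Record K :=
  fun j => if hj : (j : ℕ) ≤ n then p.1 ⟨j, Finset.mem_Iic.2 hj⟩ else p.2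

lemma measurable_appendRecord (n : ℕ) :
    Measurable (appendRecord n : (Finset.Iic n → Record K) × Record K → _) := by
  refine measurable_pi_lambda _ fun j => ?_
  unfold appendRecord
  split_ifs
  · exact (measurable_pi_apply _).comp measurable_fst
  · exact measurable_snd

lemma appendRecord_frestrictLe (n : ℕ) (ω : ℕ → Record K) :
    appendRecord n (Preorder.frestrictLe n ω, ω (n + 1)) = Preorder.frestrictLe (n + 1) ω := by
  ext j : 1
  unfold appendRecord
  split_ifs with hj
  · rfl
  · have h : (j : ℕ) = n + 1 := by
      have := Finset.mem_Iic.1 j.2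
      omega
    rw [Preorder.frestrictLe_apply, h]

/-- The likelihood ratio of two instances on the first `n + 1` records. -/
lemma lintegral_law_change (hw : Measurable w) (hw1 : ∀ k, w (Sum.inr k) = 1)
    (hdens : ∀ a, (ν a : Measure ℝ) = (μ a : Measure ℝ).withDensity fun x => w (Sum.inl (a, x)))
    (n : ℕ) {f : (Finset.Iic n → Record K) → ℝ≥0∞} (hf : Measurable f) :
    ∫⁻ ω, f (Preorder.frestrictLe n ω) ∂law τ₁ off on ν =
      ∫⁻ ω, (∏ k ∈ Finset.range (n + 1), w (ω k)) * f (Preorder.frestrictLe n ω)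
        ∂law τ₁ off on μ := by
  induction n with
  | zero =>
    have key : ∀ ω : ℕ → Record K, Preorder.frestrictLe 0 ω = fun _ => ω 0 := by
      intro ω
      ext j : 1
      have h : (j : ℕ) = 0 := Nat.le_zero.1 (Finset.mem_Iic.1 j.2)
      rw [Preorder.frestrictLe_apply, h]
    have hm : Measurable fun r : Record K => f fun _ => r := hf.comp (by fun_prop)
    simp only [key, zero_add, Finset.prod_range_one]
    rw [lintegral_law_zero τ₁ off on ν hm,
      lintegral_law_zero τ₁ off on μ (g := fun r => w r * f fun _ => r) (hw.mul hm),
      lintegral_nextRecord_change _ _ _ hw hw1 hdens _ _ hm]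
  | succ n ih =>
    have hF : Measurable fun p => f (appendRecord n p) := hf.comp (measurable_appendRecord n)
    have hwF : Measurable fun p : (Finset.Iic n → Record K) × Record K =>
        w p.2 * f (appendRecord n p) := (hw.comp measurable_snd).mul hF
    have hP : Measurable fun h : Finset.Iic n → Record K =>
        ∏ k : Finset.Iic n, w (h k) :=
      Finset.measurable_prod _ fun k _ => hw.comp (measurable_pi_apply k)
    have hprod : ∀ ω : ℕ → Record K, ∏ k : Finset.Iic n, w (Preorder.frestrictLe n ω k) =
        ∏ k ∈ Finset.range (n + 1), w (ω k) := by
      intro ω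
      rw [Finset.univ_eq_attach, ← Finset.prod_attach (Finset.range (n + 1))]
      have : Finset.range (n + 1) = Finset.Iic n := by ext; simp
      rw [this]
      rfl
    simp only [← appendRecord_frestrictLe]
    rw [lintegral_law_succ τ₁ off on ν n hF]
    have hstep : ∀ h, ∫⁻ r, f (appendRecord n (h, r)) ∂step τ₁ off on ν n h =
        ∫⁻ r, w r * f (appendRecord n (h, r)) ∂step τ₁ off on μ n h := fun h =>
      lintegral_step_change _ _ _ hw hw1 hdens n h (hF.comp measurable_prodMk_left)
    simp only [hstep]
    -- The inner integral depends only on records `0, …, n`, so the induction hypothesis applies to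
    -- it.
    rw [ih (f := fun h => ∫⁻ r, w r * f (appendRecord n (h, r)) ∂step τ₁ off on μ n h)
      hwF.lintegral_kernel_prod_right']
    have := lintegral_law_succ τ₁ off on μ n
      (g := fun p => (∏ k : Finset.Iic n, w (p.1 k)) * (w p.2 * f (appendRecord n p)))
      ((hP.comp measurable_fst).mul hwF)
    simp only [hprod] at this
    simp only [fun ω : ℕ → Record K => Finset.prod_range_succ (fun k => w (ω k)) (n + 1), mul_assoc,
      this]
    refine lintegral_congr fun ω => ?_
    exact (lintegral_const_mul _ (hwF.comp measurable_prodMk_left)).symm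

end ChangeOfMeasure

end Law

/-! ### A numerical bound on the binary divergence -/

/-- Tangent lines to the convex functions `x log x` and `-log x` reduce the bound to its values
at the two ends of the interval. -/
lemma log_le_binary_div {δ : ℝ} (hδ : 0 < δ) (h : 2.4 * δ < 1) :
    Real.log (1 / (2.4 * δ)) ≤ (1 - 2 * δ) * Real.log ((1 - δ) / δ) := by
  have hδ1 : 0 < 1 - δ := by linarith
  have tangent : ∀ x t : ℝ, 0 < x → 0 < t → 1 - t / x ≤ Real.log x - Real.log t := by
    intro x t hx ht
    have := Real.one_sub_inv_le_log_of_pos (div_pos hx ht)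
    rwa [inv_div, Real.log_div hx.ne' ht.ne'] at this
  have tangent' : ∀ x t : ℝ, 0 < x → 0 < t → x - t ≤ x * (Real.log x - Real.log t) := by
    intro x t hx ht
    have := mul_le_mul_of_nonneg_left (tangent x t hx ht) hx.le
    rwa [mul_sub, mul_one, mul_div_cancel₀ _ hx.ne'] at this
  -- All tangents are taken at `δ = 10 / 31`, close to where the inequality is tightest. The
  -- resulting lower bound is affine in `δ`; `e0` is its sign at `δ = 0`, and `e1` is six times its
  -- value at `δ = 5 / 12`.
  have h1 := tangent' δ (10 / 31) hδ (by norm_num)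
  have h2 := tangent' (1 - δ) (21 / 31) hδ1 (by norm_num)
  have h3 := tangent (21 / 31) (1 - δ) (by norm_num) hδ1
  have e0 : 10 / 21 ≤ Real.log 2.4 + Real.log (21 / 31) := by
    rw [← Real.log_mul (by norm_num) (by norm_num)]
    have := Real.le_log_one_add_of_nonneg (x := 2.4 * (21 / 31) - 1) (by norm_num)
    rw [add_sub_cancel] at this
    refine le_trans ?_ this
    norm_num
  have e1 : 0 ≤ 6 * Real.log 2.4 + 5 * Real.log (10 / 31) + Real.log (21 / 31) + 5 / 6 := by
    -- This is `e1` exponentiated: `31 / 24` and `31 / 50.4` are the inverses of `2.4 * (10 / 31)`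
    -- and `2.4 * (21 / 31)`.
    have hexp : (31 / 24 : ℝ) ^ 5 * 31 / 50.4 ≤ Real.exp (5 / 6) := by
      have := Real.sum_le_exp_of_nonneg (x := 5 / 6) (by norm_num) 4
      refine le_trans ?_ this
      norm_num [Finset.sum_range_succ, Nat.factorial]
    have := (Real.log_le_iff_le_exp (by norm_num)).2 hexp
    have hl : Real.log ((31 / 24 : ℝ) ^ 5 * 31 / 50.4) =
        -(6 * Real.log 2.4 + 5 * Real.log (10 / 31) + Real.log (21 / 31)) := by
      have : ((31 / 24 : ℝ) ^ 5 * 31 / 50.4) = (2.4 ^ 6 * (10 / 31) ^ 5 * (21 / 31))⁻¹ := by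
        norm_num
      rw [this, Real.log_inv, Real.log_mul (by norm_num) (by norm_num),
        Real.log_mul (by norm_num) (by norm_num), Real.log_pow, Real.log_pow]
      norm_num
    linarith
  rw [one_div, Real.log_inv, Real.log_mul (by norm_num) hδ.ne', Real.log_div hδ1.ne' hδ.ne']
  nlinarith [mul_nonneg hδ.le e1, mul_nonneg (sub_nonneg.2 h.le) (sub_nonneg.2 e0)]

/-! ### The information needed to tell two instances apart -/

section Information

variable {K : ℕ} {F : SPEF} (τ₁ : ℕ) (off : OfflinePolicy K) (on : OnlinePolicy K)
  {μ ν : Fin K → ProbabilityMeasure ℝ} {θ θ' : Fin K → ℝ}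

/-- The logarithm of the likelihood ratio of two instances for a single record. -/
noncomputable def logRatio (F : SPEF) (θ θ' : Fin K → ℝ) : Record K → ℝ :=
  Sum.elim (fun p => (θ p.1 - θ' p.1) * p.2 - (F.b (θ p.1) - F.b (θ' p.1))) fun _ => 0

lemma measurable_logRatio : Measurable (logRatio F θ θ') := by
  have h : ∀ u : Fin K → ℝ, Measurable fun p : Obs K => u p.1 := fun u =>
    (measurable_of_finite u).comp measurable_fst
  exact Measurable.sumElim
    (((h fun a => θ a - θ' a).mul measurable_snd).sub (h fun a => F.b (θ a) - F.b (θ' a)))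
    measurable_const

lemma measurableSet_outputAt (n : ℕ) (k : Fin K) :
    MeasurableSet {ω : ℕ → Record K | ω n = Sum.inr k} := by
  have hS : MeasurableSet ({Sum.inr k} : Set (Record K)) := by
    rw [← Set.image_singleton]
    exact (measurableSet_singleton k).inr_image
  have h : Measurable fun ω : ℕ → Record K => ω n := measurable_pi_apply n
  exact h hS

lemma outputs_eq_iUnion (k : Fin K) :
    {ω : ℕ → Record K | Outputs ω k} = ⋃ n, {ω | ω n = Sum.inr k} := by
  ext ω
  simp [Outputs]

/-- Gibbs' variational bound for the first `n + 1` records and a test function of the event that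
record `n` is the output `i`. -/
lemma gibbs_le_sum_div (hθ : ∀ a, θ a ∈ F.Θ) (hμ : ∀ a, (μ a : Measure ℝ) = F.dist (θ a))
    (hν : ∀ a, (ν a : Measure ℝ) = F.dist (θ' a)) (n : ℕ) (i : Fin K) (α β : ℝ) :
    1 + β + (α - β) * (law τ₁ off on μ).real {ω | ω n = Sum.inr i} -
        (Real.exp β + (Real.exp α - Real.exp β) *
          (law τ₁ off on ν).real {ω | ω n = Sum.inr i}) ≤
      ∑ k ∈ Finset.range (n + 1), ∑ a, (law τ₁ off on μ).real {ω | ω k ∈ armSet a} *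
        F.div (θ a) (θ' a) := by
  classical
  set A : Set (ℕ → Record K) := {ω | ω n = Sum.inr i} with hA
  have hAm : MeasurableSet A := measurableSet_outputAt n i
  set l := logRatio F θ θ' with hl
  have hlm : Measurable l := measurable_logRatio
  have hlint : ∀ a, Integrable (fun x => l (Sum.inl (a, x))) (μ a : Measure ℝ) := fun a => by
    rw [hμ a]
    exact SPEF.integrable_logRatio (hθ a) (θ' a)
  have hlI : ∀ a, ∫ x, l (Sum.inl (a, x)) ∂(μ a : Measure ℝ) = F.div (θ a) (θ' a) := fun a => by
    rw [hμ a]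
    exact SPEF.integral_logRatio (hθ a) (θ' a)
  set L : (ℕ → Record K) → ℝ := fun ω => ∑ k ∈ Finset.range (n + 1), l (ω k) with hL
  have hLm : Measurable L := Finset.measurable_sum _ fun k _ => hlm.comp (measurable_pi_apply k)
  have hLi : Integrable L (law τ₁ off on μ) :=
    integrable_finsetSum _ fun k _ => integrable_law τ₁ off on μ hlm (fun _ => rfl) hlint k
  have hLI : ∫ ω, L ω ∂law τ₁ off on μ = ∑ k ∈ Finset.range (n + 1),
      ∑ a, (law τ₁ off on μ).real {ω | ω k ∈ armSet a} * F.div (θ a) (θ' a) := by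
    rw [integral_finsetSum _ fun k _ => integrable_law τ₁ off on μ hlm (fun _ => rfl) hlint k]
    refine Finset.sum_congr rfl fun k _ => ?_
    rw [integral_law τ₁ off on μ hlm (fun _ => rfl) hlint k]
    simp only [hlI]
  -- The test function: `α` on `A` and `β` off it.
  set g : (ℕ → Record K) → ℝ := fun ω => β + A.indicator (fun _ => α - β) ω with hg
  have hgm : Measurable g := measurable_const.add (measurable_const.indicator hAm)
  have hgi : Integrable g (law τ₁ off on μ) :=
    (integrable_const _).add ((integrable_const _).indicator hAm)
  have hgI : ∫ ω, g ω ∂law τ₁ off on μ = β + (α - β) * (law τ₁ off on μ).real A := by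
    rw [integral_add (integrable_const _) ((integrable_const _).indicator hAm),
      integral_indicator_const _ hAm]
    simp [mul_comm]
  have hexpg : (fun ω => Real.exp (g ω)) =
      fun ω => Real.exp β + A.indicator (fun _ => Real.exp α - Real.exp β) ω := by
    ext ω
    by_cases hω : ω ∈ A <;> simp [hg, hω]
  have hegi : Integrable (fun ω => Real.exp (g ω)) (law τ₁ off on ν) := by
    rw [hexpg]
    exact (integrable_const _).add ((integrable_const _).indicator hAm)
  have hegI : ∫ ω, Real.exp (g ω) ∂law τ₁ off on ν =
      Real.exp β + (Real.exp α - Real.exp β) * (law τ₁ off on ν).real A := by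
    rw [hexpg, integral_add (integrable_const _) ((integrable_const _).indicator hAm),
      integral_indicator_const _ hAm]
    simp [mul_comm]
  set w : Record K → ℝ≥0∞ := fun r => ENNReal.ofReal (Real.exp (-l r)) with hw
  have hwm : Measurable w := by fun_prop
  have hdens : ∀ a, (ν a : Measure ℝ) =
      (μ a : Measure ℝ).withDensity fun x => w (Sum.inl (a, x)) := fun a => by
    rw [hμ a, hν a, SPEF.dist_eq_withDensity (θ a) (θ' a)]
    congr 1
    ext x
    simp only [hw, hl, logRatio, Sum.elim_inl]
    ring_nf
  have hchange : ∫⁻ ω, ENNReal.ofReal (Real.exp (g ω)) ∂law τ₁ off on ν =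
      ∫⁻ ω, ENNReal.ofReal (Real.exp (g ω - L ω)) ∂law τ₁ off on μ := by
    have hS : MeasurableSet {h : Finset.Iic n → Record K | lastRecord n h = Sum.inr i} := by
      have : MeasurableSet ({Sum.inr i} : Set (Record K)) := by
        rw [← Set.image_singleton]
        exact (measurableSet_singleton i).inr_image
      exact measurable_lastRecord n this
    have h := lintegral_law_change τ₁ off on hwm (fun k => by simp [hw, hl, logRatio]) hdens n
      (f := fun h => ENNReal.ofReal (Real.exp
        (β + {h : Finset.Iic n → Record K | lastRecord n h = Sum.inr i}.indicator
          (fun _ => α - β) h)))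
      (Real.measurable_exp.comp
        (measurable_const.add (measurable_const.indicator hS))).ennreal_ofReal
    refine h.trans (lintegral_congr fun ω => ?_)
    rw [← ENNReal.ofReal_prod_of_nonneg fun k _ => (Real.exp_pos _).le, ← Real.exp_sum,
      ← ENNReal.ofReal_mul (Real.exp_pos _).le, ← Real.exp_add, Finset.sum_neg_distrib,
      neg_add_eq_sub]
    rfl
  -- Finiteness is read off on the `ν` side, where the integrand is bounded.
  have hfin : ∫⁻ ω, ENNReal.ofReal (Real.exp (g ω - L ω)) ∂law τ₁ off on μ ≠ ∞ := by
    rw [← hchange]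
    exact hegi.lintegral_lt_top.ne
  have hi : Integrable (fun ω => Real.exp (g ω - L ω)) (law τ₁ off on μ) :=
    ⟨(Real.measurable_exp.comp (hgm.sub hLm)).aestronglyMeasurable, by
      rw [hasFiniteIntegral_iff_ofReal (ae_of_all _ fun x => (Real.exp_pos _).le)]
      exact hfin.lt_top⟩
  have hI : ∫ ω, Real.exp (g ω - L ω) ∂law τ₁ off on μ = ∫ ω, Real.exp (g ω) ∂law τ₁ off on ν := by
    rw [integral_eq_lintegral_of_nonneg_ae (ae_of_all _ fun x => (Real.exp_pos _).le)
        hi.aestronglyMeasurable,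
      integral_eq_lintegral_of_nonneg_ae (ae_of_all _ fun x => (Real.exp_pos _).le)
        hegi.aestronglyMeasurable, hchange]
  -- Gibbs' inequality in linearized form, from `y + 1 ≤ exp y`.
  have hmono : ∫ ω, (g ω - L ω + 1) ∂law τ₁ off on μ ≤
      ∫ ω, Real.exp (g ω - L ω) ∂law τ₁ off on μ :=
    integral_mono ((hgi.sub hLi).add (integrable_const _)) hi fun ω => Real.add_one_le_exp _
  rw [hI, hegI, integral_add (f := fun ω => g ω - L ω) (hgi.sub hLi) (integrable_const _),
    integral_sub hgi hLi, hgI,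
    hLI] at hmono
  simp only [integral_const, probReal_univ, smul_eq_mul, mul_one] at hmono
  linarith

/-- Stops are absorbing, so these events almost surely increase to their union. -/
lemma tendsto_law_outputAt (k : Fin K) :
    Tendsto (fun n => (law τ₁ off on μ).real {ω | ω n = Sum.inr k}) atTop
      (𝓝 ((law τ₁ off on μ).real {ω | Outputs ω k})) := by
  rw [outputs_eq_iUnion]
  refine ((ENNReal.tendsto_toReal (measure_ne_top _ _)).comp
    (tendsto_measure_iUnion_accumulate (μ := law τ₁ off on μ)
      (f := fun n => {ω : ℕ → Record K | ω n = Sum.inr k}))).congr fun n => ?_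
  refine congrArg ENNReal.toReal (measure_congr ?_)
  filter_upwards [law_stopped_mono τ₁ off on μ] with ω hω
  refine propext ⟨fun h => ?_, fun h => Set.subset_accumulate h⟩
  obtain ⟨m, hm, h⟩ := Set.mem_accumulate.1 h
  exact hω k m n hm h

/-- The expected number of pulls of arm `a` in all rounds. -/
noncomputable def expectedPulls (τ₁ : ℕ) (off : OfflinePolicy K) (on : OnlinePolicy K)
    (μ : Fin K → ProbabilityMeasure ℝ) (a : Fin K) : ℝ≥0∞ :=
  ∑' n, law τ₁ off on μ {ω | ω n ∈ armSet a}

/-- The transportation inequality: a `δ`-correct policy collects enough information to tell apart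
two instances with different best arms. -/
theorem log_le_sum_expectedPulls_mul_div {δ : ℝ} (hδ : 0 < δ) (hδ' : 2.4 * δ < 1)
    (hcorrect : IsDeltaCorrect F τ₁ off on δ)
    (hθ : ∀ a, θ a ∈ F.Θ) (hμ : ∀ a, (μ a : Measure ℝ) = F.dist (θ a))
    (hθ' : ∀ a, θ' a ∈ F.Θ) (hν : ∀ a, (ν a : Measure ℝ) = F.dist (θ' a))
    {i c : Fin K} (hi : IsUniqueBest μ i) (hc : IsUniqueBest ν c) (hci : c ≠ i) :
    ENNReal.ofReal (Real.log (1 / (2.4 * δ))) ≤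
      ∑ a, expectedPulls τ₁ off on μ a * ENNReal.ofReal (F.div (θ a) (θ' a)) := by
  set B := ∑ a, expectedPulls τ₁ off on μ a * ENNReal.ofReal (F.div (θ a) (θ' a)) with hB
  have hδ1 : 0 < 1 - δ := by linarith
  -- The optimal test function is the log-ratio of the Bernoulli laws `1 - δ` and `δ`: it is `α` on
  -- the event and `-α` off it. Its exponential moment is exactly `1` when the event has probability
  -- `δ`.
  set α := Real.log ((1 - δ) / δ) with hα
  have hα0 : 0 ≤ α := Real.log_nonneg ((one_le_div hδ).2 (by linarith))
  have hexpα : Real.exp α = (1 - δ) / δ := Real.exp_log (div_pos hδ1 hδ)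
  have hexpα' : Real.exp (-α) = δ / (1 - δ) := by rw [Real.exp_neg, hexpα, inv_div]
  -- Under `ν` the output `i` is an error: absorption excludes a second output `c`.
  have hQ : ∀ n, (law τ₁ off on ν).real {ω | ω n = Sum.inr i} ≤ δ := by
    intro n
    refine ENNReal.toReal_le_of_le_ofReal hδ.le
      ((measure_mono_ae ?_).trans (hcorrect ν (fun a => ⟨θ' a, hθ' a, hν a⟩) c hc))
    filter_upwards [law_stopped_mono τ₁ off on ν] with ω hω hn
    rintro ⟨m, hm⟩
    have h1 := hω i n (max n m) (le_max_left _ _) hn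
    have h2 := hω c m (max n m) (le_max_right _ _) hm
    exact hci (Sum.inr_injective (h2.symm.trans h1))
  have hP : 1 - δ ≤ (law τ₁ off on μ).real {ω | Outputs ω i} := by
    have hm : MeasurableSet {ω : ℕ → Record K | Outputs ω i} := by
      rw [outputs_eq_iUnion]
      exact MeasurableSet.iUnion fun n => measurableSet_outputAt n i
    have h := ENNReal.toReal_le_of_le_ofReal hδ.le
      (hcorrect μ (fun a => ⟨θ a, hθ a, hμ a⟩) i hi)
    have h2 := probReal_compl_eq_one_sub (μ := law τ₁ off on μ) hm
    change (law τ₁ off on μ).real {ω | Outputs ω i}ᶜ ≤ δ at h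
    linarith
  have hn : ∀ n, ENNReal.ofReal (1 - α + 2 * α * (law τ₁ off on μ).real {ω | ω n = Sum.inr i} -
      1) ≤ B := by
    intro n
    have h := gibbs_le_sum_div τ₁ off on hθ hμ hν n i α (-α)
    have hle : Real.exp (-α) + (Real.exp α - Real.exp (-α)) *
        (law τ₁ off on ν).real {ω | ω n = Sum.inr i} ≤ 1 := by
      calc _ ≤ Real.exp (-α) + (Real.exp α - Real.exp (-α)) * δ := by
            gcongr
            · exact sub_nonneg.2 (Real.exp_le_exp.2 (by linarith))
            · exact hQ n
        _ = 1 := by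
            rw [hexpα, hexpα']
            field_simp
            ring
    have h' : 1 - α + 2 * α * (law τ₁ off on μ).real {ω | ω n = Sum.inr i} - 1 ≤
        ∑ k ∈ Finset.range (n + 1), ∑ a, (law τ₁ off on μ).real {ω | ω k ∈ armSet a} *
          F.div (θ a) (θ' a) := by linarith
    refine (ENNReal.ofReal_le_ofReal h').trans ?_
    rw [Finset.sum_comm, ENNReal.ofReal_sum_of_nonneg fun a _ => Finset.sum_nonneg fun k _ =>
      mul_nonneg measureReal_nonneg (SPEF.div_nonneg (hθ a) (hθ' a))]
    refine Finset.sum_le_sum fun a _ => ?_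
    rw [← Finset.sum_mul, ENNReal.ofReal_mul (Finset.sum_nonneg fun k _ => measureReal_nonneg),
      ENNReal.ofReal_sum_of_nonneg fun k _ => measureReal_nonneg]
    gcongr
    exact (Finset.sum_congr rfl fun k _ => ofReal_measureReal).trans_le (ENNReal.sum_le_tsum _)
  have hlim := le_of_tendsto' (ENNReal.tendsto_ofReal
    ((((tendsto_law_outputAt τ₁ off on (μ := μ) i).const_mul (2 * α)).const_add
      (1 - α)).sub_const 1)) hn
  refine le_trans (ENNReal.ofReal_le_ofReal ?_) hlim
  refine (log_le_binary_div hδ hδ').trans ?_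
  nlinarith [mul_le_mul_of_nonneg_left hP hα0]

end Information

/-! ### The lower bound -/

section LowerBound

variable {K : ℕ} {F : SPEF} (τ₁ : ℕ) (off : OfflinePolicy K) (on : OnlinePolicy K)
  {μ : Fin K → ProbabilityMeasure ℝ} {θ : Fin K → ℝ}

lemma isUniqueBest_of_lt {ν : Fin K → ProbabilityMeasure ℝ} (hθ : ∀ a, θ a ∈ F.Θ)
    (hν : ∀ a, (ν a : Measure ℝ) = F.dist (θ a)) {c : Fin K} (hc : ∀ a, a ≠ c → θ a < θ c) :
    IsUniqueBest ν c := by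
  intro a ha
  rw [mean, mean, hν, hν]
  exact SPEF.m_strictMonoOn (hθ a) (hθ c) (hc a ha)

/-- Moving the arms `i` and `a` to a common distribution leaves `i` behind some arm `c` after an
arbitrarily small push of `c`. -/
theorem log_le_mul_div_add {δ : ℝ} (hδ : 0 < δ) (hδ' : 2.4 * δ < 1)
    (hcorrect : IsDeltaCorrect F τ₁ off on δ)
    (hθ : ∀ a, θ a ∈ F.Θ) (hμ : ∀ a, (μ a : Measure ℝ) = F.dist (θ a))
    {i a : Fin K} (hi : IsUniqueBest μ i) (hai : a ≠ i)
    (hfin : ∀ b, expectedPulls τ₁ off on μ b ≠ ∞) {ξ : ℝ} (hξ : ξ ∈ F.Θ) :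
    ENNReal.ofReal (Real.log (1 / (2.4 * δ))) ≤
      expectedPulls τ₁ off on μ i * ENNReal.ofReal (F.div (θ i) ξ) +
        expectedPulls τ₁ off on μ a * ENNReal.ofReal (F.div (θ a) ξ) := by
  classical
  set θ₀ : Fin K → ℝ := fun b => if b = i ∨ b = a then ξ else θ b with hθ₀
  have hθ₀mem : ∀ b, θ₀ b ∈ F.Θ := fun b => by
    simp only [hθ₀]
    split_ifs
    exacts [hξ, hθ b]
  -- The arm to push need not be `a`: when `ξ` is low, a third arm may lead.
  obtain ⟨c, hc, hmax⟩ := Finset.exists_max_image (Finset.univ.erase i) θ₀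
    ⟨a, Finset.mem_erase.2 ⟨hai, Finset.mem_univ a⟩⟩
  have hci : c ≠ i := (Finset.mem_erase.1 hc).1
  have hle : ∀ b, θ₀ b ≤ θ₀ c := by
    intro b
    by_cases hb : b = i
    · have h : θ₀ b = θ₀ a := by simp [hθ₀, hb]
      rw [h]
      exact hmax a (Finset.mem_erase.2 ⟨hai, Finset.mem_univ a⟩)
    · exact hmax b (Finset.mem_erase.2 ⟨hb, Finset.mem_univ b⟩)
  have hcont : Tendsto (fun t => θ₀ c + t) (𝓝 0) (𝓝 (θ₀ c)) := by
    have : Continuous fun t : ℝ => θ₀ c + t := by fun_prop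
    simpa using this.tendsto 0
  have hev : ∀ᶠ t in 𝓝[>] (0 : ℝ), ENNReal.ofReal (Real.log (1 / (2.4 * δ))) ≤
      ∑ b, expectedPulls τ₁ off on μ b *
        ENNReal.ofReal (F.div (θ b) (Function.update θ₀ c (θ₀ c + t) b)) := by
    filter_upwards [self_mem_nhdsWithin,
      nhdsWithin_le_nhds (hcont.eventually (F.isOpen_Θ.mem_nhds (hθ₀mem c)))] with t ht htmem
    have hmem : ∀ b, Function.update θ₀ c (θ₀ c + t) b ∈ F.Θ := fun b => by
      by_cases hb : b = c
      · subst hb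
        rwa [Function.update_self]
      · simpa [hb] using hθ₀mem b
    let ν : Fin K → ProbabilityMeasure ℝ := fun b =>
      ⟨F.dist (Function.update θ₀ c (θ₀ c + t) b), SPEF.isProbabilityMeasure_dist (hmem b)⟩
    refine log_le_sum_expectedPulls_mul_div (ν := ν) τ₁ off on hδ hδ' hcorrect hθ hμ hmem
      (fun _ => rfl) hi (isUniqueBest_of_lt hmem (fun _ => rfl) fun b hb => ?_) hci
    rw [Function.update_self, Function.update_of_ne hb]
    exact (hle b).trans_lt (lt_add_of_pos_right _ ht)
  have hdiv : ∀ b, Tendsto (fun t => F.div (θ b) (Function.update θ₀ c (θ₀ c + t) b))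
      (𝓝[>] (0 : ℝ)) (𝓝 (F.div (θ b) (θ₀ b))) := by
    intro b
    by_cases hb : b = c
    · subst hb
      simp only [Function.update_self]
      have h1 : Tendsto (fun t => F.b (θ₀ b + t)) (𝓝 0) (𝓝 (F.b (θ₀ b))) :=
        (SPEF.continuousOn_b.continuousAt (F.isOpen_Θ.mem_nhds (hθ₀mem b))).tendsto.comp hcont
      exact ((h1.sub_const _).sub ((hcont.sub_const _).mul_const _)).mono_left nhdsWithin_le_nhds
    · simp only [Function.update_of_ne hb]
      exact tendsto_const_nhds
  -- Let the push tend to `0`. Finite expected pulls are needed here, since multiplication by `∞` is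
  -- not continuous at `0`.
  have hlim := ge_of_tendsto (tendsto_finsetSum Finset.univ fun b _ =>
    ENNReal.Tendsto.const_mul (ENNReal.tendsto_ofReal (hdiv b)) (Or.inr (hfin b))) hev
  refine hlim.trans_eq ?_
  rw [Finset.sum_eq_add i a hai.symm]
  · simp [hθ₀]
  · rintro b - ⟨hbi, hba⟩
    simp [hθ₀, hbi, hba, SPEF.div]
  · simp
  · simp

/-! ### Offline and online pulls -/

lemma expectedPulls_eq_add (a : Fin K) :
    expectedPulls τ₁ off on μ a = ∫⁻ ω, offlineCount τ₁ a ω ∂law τ₁ off on μ +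
      ∑' t, law τ₁ off on μ {ω | ω (τ₁ + t) ∈ armSet a} := by
  have hm : ∀ n, Measurable fun ω : ℕ → Record K =>
      (armSet a).indicator (1 : Record K → ℝ≥0∞) (ω n) := fun n =>
    (measurable_one.indicator (measurableSet_armSet a)).comp (measurable_pi_apply n)
  have h : ∫⁻ ω, offlineCount τ₁ a ω ∂law τ₁ off on μ =
      ∑ n ∈ Finset.range τ₁, law τ₁ off on μ {ω | ω n ∈ armSet a} := by
    refine (lintegral_finsetSum _ fun n _ => hm n).trans (Finset.sum_congr rfl fun n _ => ?_)
    exact lintegral_indicator_one (s := {ω : ℕ → Record K | ω n ∈ armSet a})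
      (measurable_pi_apply n (measurableSet_armSet a))
  simp only [add_comm τ₁]
  rw [h, expectedPulls, ENNReal.summable.sum_add_tsum_nat_add']

/-- Each online sample belongs to exactly one arm; sums and integrals are then exchanged. -/
lemma sum_online_eq_lintegral_onlineTime :
    ∑ a, ∑' t, law τ₁ off on μ {ω | ω (τ₁ + t) ∈ armSet a} =
      ∫⁻ ω, onlineTime τ₁ ω ∂law τ₁ off on μ := by
  have hm : ∀ a n, Measurable fun ω : ℕ → Record K =>
      (armSet a).indicator (1 : Record K → ℝ≥0∞) (ω n) := fun a n =>
    (measurable_one.indicator (measurableSet_armSet a)).comp (measurable_pi_apply n)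
  simp only [onlineTime, ← sum_indicator_armSet]
  rw [lintegral_tsum fun t => (Finset.measurable_sum _ fun a _ => hm a (τ₁ + t)).aemeasurable,
    ← Summable.tsum_finsetSum fun a _ => ENNReal.summable]
  refine tsum_congr fun t => ?_
  rw [lintegral_finsetSum _ fun a _ => hm a (τ₁ + t)]
  refine Finset.sum_congr rfl fun a _ => ?_
  exact (lintegral_indicator_one (s := {ω : ℕ → Record K | ω (τ₁ + t) ∈ armSet a})
    (measurable_pi_apply (τ₁ + t) (measurableSet_armSet a))).symm

lemma lintegral_offlineCount_ne_top (a : Fin K) :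
    ∫⁻ ω, offlineCount τ₁ a ω ∂law τ₁ off on μ ≠ ∞ := by
  refine ne_top_of_le_ne_top (ENNReal.natCast_ne_top τ₁) ?_
  calc ∫⁻ ω, offlineCount τ₁ a ω ∂law τ₁ off on μ
      ≤ ∫⁻ _, (τ₁ : ℝ≥0∞) ∂law τ₁ off on μ := by
        refine lintegral_mono fun ω => ?_
        refine (Finset.sum_le_card_nsmul _ _ 1 fun n _ => ?_).trans (by simp)
        exact Set.indicator_le_self' (fun _ _ => zero_le_one) _
    _ = τ₁ := by simp

end LowerBound

end OfflineOnline

theorem theorem1 {K : ℕ} (F : OfflineOnline.SPEF) (τ₁ : ℕ)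
    (off : OfflineOnline.OfflinePolicy K) (on : OfflineOnline.OnlinePolicy K)
    (δ : ℝ) (hδ : 0 < δ) (hcorrect : OfflineOnline.IsDeltaCorrect F τ₁ off on δ)
    (μ : Fin K → ProbabilityMeasure ℝ) (hμ : ∀ a, μ a ∈ F.family)
    (i : Fin K) (hbest : OfflineOnline.IsUniqueBest μ i) :
    OfflineOnline.optimalValue F μ
        (fun a => ∫⁻ ω, OfflineOnline.offlineCount τ₁ a ω ∂OfflineOnline.law τ₁ off on μ) i δ ≤
      ∫⁻ ω, OfflineOnline.onlineTime τ₁ ω ∂OfflineOnline.law τ₁ off on μ := by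
  open OfflineOnline in
  rcases eq_or_ne (∫⁻ ω, onlineTime τ₁ ω ∂law τ₁ off on μ) ∞ with htop | htop
  · rw [htop]
    exact le_top
  choose θ hθ hdist using hμ
  rw [← sum_online_eq_lintegral_onlineTime] at htop ⊢
  have hN : ∀ a, ∑' t, law τ₁ off on μ {ω | ω (τ₁ + t) ∈ armSet a} ≠ ∞ := fun a =>
    (ENNReal.sum_ne_top.1 htop) a (Finset.mem_univ a)
  have hcoe : ∀ a, (((∑' t, law τ₁ off on μ {ω | ω (τ₁ + t) ∈ armSet a}).toNNReal : ℝ≥0) : ℝ≥0∞) =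
      ∑' t, law τ₁ off on μ {ω | ω (τ₁ + t) ∈ armSet a} := fun a => ENNReal.coe_toNNReal (hN a)
  refine (iInf₂_le (fun a => (∑' t, law τ₁ off on μ {ω | ω (τ₁ + t) ∈ armSet a}).toNNReal)
    ?_).trans_eq (Finset.sum_congr rfl fun a _ => hcoe a)
  intro a hai
  -- For `2.4 * δ ≥ 1` the required information is nonpositive, so the constraint is void.
  rcases le_or_gt 1 (2.4 * δ) with hlarge | hsmall
  · rw [ENNReal.ofReal_of_nonpos]
    · exact zero_le
    · exact Real.log_nonpos (by positivity) ((div_le_one (by positivity)).2 hlarge)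
  · refine le_iInf₂ fun x hx => ?_
    obtain ⟨ξ, hξ, hxξ⟩ := hx
    simp only [hcoe, ← expectedPulls_eq_add]
    have hKL : ∀ b, KL (μ b) x = ENNReal.ofReal (F.div (θ b) ξ) := fun b => by
      rw [KL, hdist b, hxξ]
      exact SPEF.klDiv_dist (hθ b) hξ
    rw [hKL, hKL]
    refine log_le_mul_div_add τ₁ off on hδ hsmall hcorrect hθ hdist hbest hai (fun b => ?_) hξ
    rw [expectedPulls_eq_add]
    exact ENNReal.add_ne_top.2 ⟨lintegral_offlineCount_ne_top τ₁ off on b, hN b⟩
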